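/- Let $\{p_n\}_{n\ge 0}$ be a sequence of positive numbers with $p_0=1$, decreasing monotonically to $0$, and let $\mathcal B=\bigcup_{n\ge 0}[n,n+1]\times[0,p_n]$ be the corresponding infinite step billiard table. For $\vartheta\in\,]0,\pi/2[$ let $S(\vartheta)$ be the invariant surface of the billiard flow with velocities $(\pm\cos\vartheta,\pm\sin\vartheta)$. It is obtained by unfolding from the region $\{(X,Y):(|X|,|Y|)\in\mathcal B\}$ by the side identifications $(X,p_n)\sim(X,-p_n)$ for $n\le|X|\le n+1$ and $(k,Y)\sim(-k,Y)$ for $k\ge1$, $p_k\le|Y|\le p_{k-1}$, and the flow on it moves at unit speed in the direction $(\cos\vartheta,\sin\vartheta)$. Trajectories that hit a vertex $(k,\pm p_k)$ are continued by continuity from above, so that every trajectory is defined for all times $t\in\mathbb R$: one arriving from the left at $(k,Y)$, $k\ge 1$, passes to the right if $Y\in[-p_k,p_k[$, and hits a vertical side otherwise. An orbit on $S(\vartheta)$ is called an escape orbit if, from some time on, it never collides with a vertical side and if its $X$-coordinate tends to $+\infty$ as $t\to+\infty$. Let $L=\{0\}\times[-1,1[$ be the curve on $S(\vartheta)$ that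 corresponds to the first vertical side. For $n\ge1$ let $E^{(n)}_\vartheta\subset L$ be the set of points whose forward orbit reaches the aperture $\{n\}\times[-p_n,p_n[$ without colliding with any vertical side after leaving $L$, and put $E_\vartheta=\bigcap_{n\ge1}E^{(n)}_\vartheta$. Suppose that $p_{n+1}\le\lambda p_n$ for all $n\ge0$, where $0<\lambda<\lambda_0:=\frac{\sqrt6-1}{5}$. Then for Lebesgue-almost every $\vartheta\in\,]0,\pi/2[$ there is exactly one escape orbit on $S(\vartheta)$, and $E_\vartheta$ consists of exactly one point. -/

import Mathlib

/-- An infinite step billiard: the table is the union over `n` of the boxes `[n, n+1] × [0, p n]`,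
where the heights `p n > 0` decrease monotonically to `0` and `p 0 = 1`. -/
structure StepBilliard where
  /-- The heights of the steps. -/
  p : ℕ → ℝ
  p_zero : p 0 = 1
  p_pos : ∀ n, 0 < p n
  p_antitone : Antitone p
  p_tendsto : Filter.Tendsto p Filter.atTop (nhds 0)

namespace StepBilliard

/-- The billiard table. -/
def table (P : StepBilliard) : Set (ℝ × ℝ) :=
  ⋃ n : ℕ, Set.Icc (n : ℝ) ((n : ℝ) + 1) ×ˢ Set.Icc 0 (P.p n)

/-- Half of the vertical size of the unfolded table above `[n, n+1]`, for an integer `n`: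
it is `p n` for `n ≥ 0`, and `p m` for `n = -(m+1) < 0`. -/
def halfWidth (P : StepBilliard) (n : ℤ) : ℝ :=
  if 0 ≤ n then P.p n.toNat else P.p (-n - 1).toNat

/-- The invariant surface. Unfolding along the two coordinate axes (four copies of the table,
one for each of the four directions `(±cos θ, ±sin θ)` of motion) gives the plane region
`{(X, Y) | (|X|, |Y|) ∈ table}`, with the sides identified as follows:
* horizontal sides: `(X, p n) ~ (X, -p n)` for `n ≤ |X| ≤ n + 1`;
* vertical sides: `(k, Y) ~ (-k, Y)` for `k ≥ 1` and `p k ≤ |Y| ≤ p (k-1)`.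

After unfolding, the motion is always in the direction `(cos θ, sin θ)`. We use the right-open
representatives: a point over `[n, n+1[` has `Y ∈ [-h, h[` with `h = halfWidth n`, and a point on
the vertical side at abscissa `k` is represented by `(-k, Y)`, the point at which the motion
continues. The singular vertex `(±k, ±p k)` of angle `6π` then has the three representatives
`(k, -p k)`, `(-k, -p k)`, `(-k, p k)`, one for each of the three trajectories that leave it. -/
def surface (P : StepBilliard) : Set (ℝ × ℝ) :=
  {q | q.2 ∈ Set.Ico (-P.halfWidth ⌊q.1⌋) (P.halfWidth ⌊q.1⌋)}

/-- Identification of the horizontal sides: the representative in `[-h, h[` of `y` modulo `2h`. -/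
noncomputable def wrap (h y : ℝ) : ℝ :=
  y - 2 * h * (⌊(y + h) / (2 * h)⌋ : ℝ)

/-- What happens at the point `(k, y)`, reached from the left, for an integer abscissa `k`: if
`k ≥ 1` and `y` is outside the aperture `[-p k, p k[`, then the point is on a vertical side and the
motion continues from `(-k, y)`; otherwise the motion goes on through `(k, y)`. The right-open
aperture is the convention (continuity from above) for trajectories that hit a vertex. -/
noncomputable def glue (P : StepBilliard) (k : ℤ) (y : ℝ) : ℝ × ℝ :=
  if 0 < k ∧ ¬ (-P.p k.toNat ≤ y ∧ y < P.p k.toNat) then (-(k : ℝ), y) else ((k : ℝ), y)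

/-- `γ`, defined for all times, is a trajectory of the unit speed billiard flow in direction `θ`
on the invariant surface. -/
structure IsTrajectory (P : StepBilliard) (θ : ℝ) (γ : ℝ → ℝ × ℝ) : Prop where
  mem_surface : ∀ t, γ t ∈ P.surface
  /-- motion inside the strip `[n, n+1[ × ℝ`, `n = ⌊X⌋` -/
  inside : ∀ t s : ℝ, 0 ≤ s → (γ t).1 + s * Real.cos θ < (⌊(γ t).1⌋ : ℝ) + 1 →
    γ (t + s) = ((γ t).1 + s * Real.cos θ,
      wrap (P.halfWidth ⌊(γ t).1⌋) ((γ t).2 + s * Real.sin θ))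
  /-- passage through, or collision at, the abscissa `n + 1` -/
  crossing : ∀ t s : ℝ, 0 ≤ s → (γ t).1 + s * Real.cos θ = (⌊(γ t).1⌋ : ℝ) + 1 →
    γ (t + s) = P.glue (⌊(γ t).1⌋ + 1)
      (wrap (P.halfWidth ⌊(γ t).1⌋) ((γ t).2 + s * Real.sin θ))

/-- The curve `L = {0} × [-p 0, p 0[ = {0} × [-1, 1[` that represents the first vertical side. -/
def leftSide (P : StepBilliard) : Set (ℝ × ℝ) :=
  {q | q.1 = 0 ∧ q.2 ∈ Set.Ico (-P.p 0) (P.p 0)}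

/-- The points of the surface on vertical sides of the table: the first side `L`, and the sides
at the abscissas `k ≥ 1`, whose points are represented at `X = -k`. -/
def verticalSides (P : StepBilliard) : Set (ℝ × ℝ) :=
  P.leftSide ∪ {q | q ∈ P.surface ∧
    ∃ k : ℕ, 1 ≤ k ∧ q.1 = -(k : ℝ) ∧ q.2 ∉ Set.Ico (-P.p k) (P.p k)}

/-- The `n`-th aperture `G_n = {n} × [-p n, p n[`. -/
def aperture (P : StepBilliard) (n : ℕ) : Set (ℝ × ℝ) :=
  {q | q.1 = (n : ℝ) ∧ q.2 ∈ Set.Ico (-P.p n) (P.p n)}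

/-- `E_θ^(n)`, with `L` identified with `[-1, 1[`: the points of `L` whose forward orbit reaches
the aperture `G_n` without colliding with any vertical side after it has left `L`. -/
def reachSet (P : StepBilliard) (θ : ℝ) (n : ℕ) : Set ℝ :=
  {y | (0, y) ∈ P.leftSide ∧ ∃ γ : ℝ → ℝ × ℝ, P.IsTrajectory θ γ ∧ γ 0 = (0, y) ∧
    ∃ t : ℝ, 0 < t ∧ γ t ∈ P.aperture n ∧ ∀ s ∈ Set.Ioc 0 t, γ s ∉ P.verticalSides}

/-- `E_θ`, the intersection of the sets `E_θ^(n)` over `n ≥ 1`. -/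
def escapeSet (P : StepBilliard) (θ : ℝ) : Set ℝ :=
  ⋂ n : ℕ, ⋂ _ : 1 ≤ n, P.reachSet θ n

/-- `O` is an escape orbit of the flow in direction `θ`: a (full) orbit which, from some time on,
never collides with a vertical side, and goes to infinity. -/
def IsEscapeOrbit (P : StepBilliard) (θ : ℝ) (O : Set (ℝ × ℝ)) : Prop :=
  ∃ γ : ℝ → ℝ × ℝ, P.IsTrajectory θ γ ∧ O = Set.range γ ∧
    (∃ t₀ : ℝ, ∀ t : ℝ, t₀ < t → γ t ∉ P.verticalSides) ∧
    Filter.Tendsto (fun t => (γ t).1) Filter.atTop Filter.atTop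

end StepBilliard

open Set MeasureTheory Filter Topology

namespace StepBilliard

/-! A trajectory of slope α = tan θ is recorded by its heights at the integer abscissas: crossing
[i, i+1] adds α modulo 2 p_i. Backwards from G_n nothing obstructs it, because the boxes grow to the
left, so every point of G_n has exactly one direct backward path to G_m. The part of G_m that
reaches G_n is therefore a piecewise translate of G_n, cut only where a vertex over some G_k, m ≤ k
< n, itself reaches G_n. If none does (`Uncut`), it is a single interval of length 2 p_n
(`sub_eq_of_uncut`). If this happens for a fixed m and infinitely many n, these nested intervals
shrink to one point (`exists_unique_of_uncut`). They are half-open, so coinciding right ends must be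
excluded, at the cost of countably many α.

For slopes within r of a given x, the trajectory from vertex k meets G_n, n = k+1+d, at height
(d+1)α + c, with at most 3^d (r/p_k + 2) values of c. The slopes that hit G_n thus have measure at
most 3^d λ^(d+1)/(d+1) · (2r + 4p_k). Since λ < 0.29, the sum over k ≥ m is at most 7/10 · (2r +
4p_m), uniformly in n. Once p_m is small against r, this is at most 9/10 of the ball, so the slopes
for which no m works form a null set by Lebesgue density (`ae_exists_frequently_uncut`).

A collision sends the motion to a negative abscissa, so an orbit going to +∞ finally crosses
apertures only; traced back from there, it leaves L directly. Escape orbits are thus the orbits of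
the points of E_θ (`isEscapeOrbit_iff`). -/

theorem wrap_mem {h : ℝ} (hh : 0 < h) (y : ℝ) : wrap h y ∈ Ico (-h) h := by
  have h1 := Int.floor_le ((y + h) / (2 * h))
  have h2 := Int.lt_floor_add_one ((y + h) / (2 * h))
  rw [le_div_iff₀ (by positivity)] at h1
  rw [div_lt_iff₀ (by positivity)] at h2
  unfold wrap
  constructor <;> nlinarith

theorem wrap_eq (h y : ℝ) : ∃ a : ℤ, wrap h y = y - 2 * h * a := ⟨_, rfl⟩

theorem eq_of_sub_eq_mul {h x y : ℝ} (hx : x ∈ Ico (-h) h) (hy : y ∈ Ico (-h) h)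
    {a : ℤ} (hxy : x - y = 2 * h * a) : x = y := by
  obtain ⟨hx1, hx2⟩ := hx
  obtain ⟨hy1, hy2⟩ := hy
  have hh : 0 < h := by linarith
  have h1 : (a : ℝ) < 1 := by nlinarith
  have h2 : (-1 : ℝ) < a := by nlinarith
  have h3 : a < 1 := by exact_mod_cast h1
  have h4 : -1 < a := by exact_mod_cast h2
  have h5 : a = 0 := by omega
  subst h5
  simp only [Int.cast_zero, mul_zero] at hxy
  linarith

theorem wrap_unique {h w y : ℝ} (hw : w ∈ Ico (-h) h) {a : ℤ} (hwy : w = y - 2 * h * a) :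
    wrap h y = w := by
  have hh : 0 < h := by linarith [hw.1, hw.2]
  obtain ⟨b, hb⟩ := wrap_eq h y
  refine eq_of_sub_eq_mul (wrap_mem hh y) hw (a := a - b) ?_
  rw [hb, hwy]
  push_cast
  ring

theorem wrap_of_mem {h y : ℝ} (hy : y ∈ Ico (-h) h) : wrap h y = y :=
  wrap_unique hy (a := 0) (by simp)

theorem wrap_wrap_add {h : ℝ} (hh : 0 < h) (x y : ℝ) :
    wrap h (wrap h x + y) = wrap h (x + y) := by
  obtain ⟨a, ha⟩ := wrap_eq h x
  obtain ⟨b, hb⟩ := wrap_eq h (x + y)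
  refine wrap_unique (wrap_mem hh _) (a := b - a) ?_
  rw [ha, hb]
  push_cast
  ring

/-- `z` records, for `m ≤ i ≤ n`, the heights at which a line of slope `α` passes through the
apertures `G_i`. -/
def IsPath (p : ℕ → ℝ) (α : ℝ) (z : ℕ → ℝ) (m n : ℕ) : Prop :=
  (∀ i, m ≤ i → i ≤ n → z i ∈ Ico (-p i) (p i)) ∧
    ∀ i, m ≤ i → i < n → ∃ a : ℤ, z (i + 1) = z i + α - 2 * p i * a

/-- The trajectory of slope `α` that leaves the vertex above `G_k` reaches `G_n` directly. -/
def VertexReaches (p : ℕ → ℝ) (k n : ℕ) (α : ℝ) : Prop :=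
  ∃ z, IsPath p α z (k + 1) n ∧ ∃ a : ℤ, z (k + 1) = α - p k - 2 * p k * a

/-- No vertex between the levels `m` and `n` reaches `G_n`. -/
def Uncut (p : ℕ → ℝ) (m n : ℕ) (α : ℝ) : Prop :=
  ∀ k, m ≤ k → k < n → ¬ VertexReaches p k n α

/-- The forward orbit of `y ∈ L`, as long as it meets no vertical side. -/
noncomputable def orb (p : ℕ → ℝ) (α y : ℝ) : ℕ → ℝ
  | 0 => y
  | i + 1 => wrap (p i) (orb p α y i + α)

/-! ### Direct paths between apertures, for a fixed slope. -/

section Paths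

variable {p : ℕ → ℝ} {α : ℝ}

theorem IsPath.mono {z : ℕ → ℝ} {m n m' n' : ℕ} (h : IsPath p α z m n) (hm : m ≤ m')
    (hn : n' ≤ n) : IsPath p α z m' n' :=
  ⟨fun i h1 h2 => h.1 i (hm.trans h1) (h2.trans hn),
    fun i h1 h2 => h.2 i (hm.trans h1) (h2.trans_le hn)⟩

theorem IsPath.wrap_eq (hp : Antitone p) {z : ℕ → ℝ} {m n i : ℕ} (h : IsPath p α z m n)
    (hm : m ≤ i) (hn : i < n) : z (i + 1) = wrap (p i) (z i + α) := by
  obtain ⟨a, ha⟩ := h.2 i hm hn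
  have h1 := h.1 (i + 1) (by omega) (by omega)
  have h2 := hp (Nat.le_succ i)
  exact (wrap_unique ⟨by linarith [h1.1], by linarith [h1.2]⟩ ha).symm

theorem IsPath.eq_orb (hp : Antitone p) {z : ℕ → ℝ} {n : ℕ} (h : IsPath p α z 0 n) :
    ∀ i, i ≤ n → z i = orb p α (z 0) i := by
  intro i
  induction i with
  | zero => intro _; rfl
  | succ i ih =>
    intro hi
    rw [h.wrap_eq hp (Nat.zero_le i) hi, ih (by omega)]
    rfl

theorem isPath_orb {y : ℝ} {n : ℕ} (h : ∀ i, i ≤ n → orb p α y i ∈ Ico (-p i) (p i)) :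
    IsPath p α (orb p α y) 0 n :=
  ⟨fun i _ h2 => h i h2, fun _ _ _ => StepBilliard.wrap_eq _ _⟩

/-- Going left from G_(m+1), the height is reduced modulo 2 p_m, which always lands in G_m: a
backward path cannot be blocked. -/
theorem exists_isPath_extend (hpos : ∀ n, 0 < p n) (m : ℕ) (z : ℕ → ℝ) :
    ∃ z' : ℕ → ℝ, (∀ i, m ≤ i → z' i = z i) ∧ ∀ n, IsPath p α z m n → IsPath p α z' 0 n := by
  induction m generalizing z with
  | zero => exact ⟨z, fun _ _ => rfl, fun _ h => h⟩
  | succ m ih =>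
    set w := Function.update z m (wrap (p m) (z (m + 1) - α)) with hw
    have hwm : w m = wrap (p m) (z (m + 1) - α) := by simp [hw]
    have hwi : ∀ i, m + 1 ≤ i → w i = z i := fun i hi => by
      rw [hw, Function.update_of_ne (by omega)]
    obtain ⟨z', h1, h2⟩ := ih w
    refine ⟨z', fun i hi => (h1 i (by omega)).trans (hwi i hi), fun n hn => h2 n ⟨?_, ?_⟩⟩
    · intro i hi hin
      rcases Nat.eq_or_lt_of_le hi with rfl | hi
      · rw [hwm]
        exact wrap_mem (hpos _) _
      · rw [hwi i hi]
        exact hn.1 i hi hin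
    · intro i hi hin
      rw [hwi (i + 1) (by omega)]
      rcases Nat.eq_or_lt_of_le hi with rfl | hi
      · obtain ⟨a, ha⟩ := StepBilliard.wrap_eq (p m) (z (m + 1) - α)
        refine ⟨-a, ?_⟩
        rw [hwm, ha]
        push_cast
        ring
      · rw [hwi i hi]
        exact hn.2 i hi hin

theorem exists_isPath_of_mem (hpos : ∀ n, 0 < p n) (m n : ℕ) {u : ℝ}
    (hu : u ∈ Ico (-p n) (p n)) : ∃ z, IsPath p α z m n ∧ z n = u := by
  obtain ⟨z, h1, h2⟩ := exists_isPath_extend (α := α) hpos n (fun _ => u)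
  refine ⟨z, (h2 n ⟨?_, ?_⟩).mono (Nat.zero_le m) le_rfl, h1 n le_rfl⟩
  · intro i h1 h2
    obtain rfl : i = n := le_antisymm h2 h1
    exact hu
  · intro i h1 h2
    omega

theorem IsPath.eq_of_eq {z z' : ℕ → ℝ} {m n : ℕ} (h : IsPath p α z m n)
    (h' : IsPath p α z' m n) (hn : z n = z' n) {i : ℕ} (hmi : m ≤ i) (hi : i ≤ n) :
    z i = z' i := by
  induction hi using Nat.decreasingInduction with
  | self => exact hn
  | of_succ k hk ih =>
    have ih := ih (by omega)
    obtain ⟨a, ha⟩ := h.2 k hmi hk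
    obtain ⟨b, hb⟩ := h'.2 k hmi hk
    refine eq_of_sub_eq_mul (h.1 k hmi hk.le) (h'.1 k hmi hk.le) (a := a - b) ?_
    push_cast
    linarith

/-- Two backward paths stay parallel until the seam ±p_k separates them. The vertex then lies
between them, and its trajectory, squeezed between the two, reaches G_n. -/
theorem sub_eq_of_uncut_of_le (hp : Antitone p) {z z' : ℕ → ℝ} {m n : ℕ}
    (hc : Uncut p m n α) (h : IsPath p α z m n) (h' : IsPath p α z' m n) (hle : z n ≤ z' n)
    {j : ℕ} (hmj : m ≤ j) (hj : j ≤ n) :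
    ∀ i, j ≤ i → i ≤ n → z' i - z i = z' n - z n := by
  induction hj using Nat.decreasingInduction with
  | self =>
    intro i h1 h2
    obtain rfl : i = n := le_antisymm h2 h1
    rfl
  | of_succ k hk ih =>
    have ih := ih (by omega)
    intro i h1 h2
    rcases Nat.eq_or_lt_of_le h1 with rfl | h1
    swap
    · exact ih i h1 h2
    obtain ⟨a, ha⟩ := h.2 k hmj hk
    obtain ⟨b, hb⟩ := h'.2 k hmj hk
    have hd := ih (k + 1) le_rfl hk
    have g1 := h.1 k hmj hk.le
    have g2 := h'.1 k hmj hk.le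
    have hpk : 0 < p k := by linarith [g1.1, g1.2]
    have hlt : z' n - z n < 2 * p k := by
      have := h.1 n (by omega) le_rfl
      have := h'.1 n (by omega) le_rfl
      have := hp hk.le
      simp only [mem_Ico] at *
      linarith
    have e : z' k - z k = z' n - z n + 2 * p k * ((b - a : ℤ) : ℝ) := by
      push_cast
      linarith
    have c1 : ((b - a : ℤ) : ℝ) < 1 := by
      have := g1.1
      have := g2.2
      nlinarith
    have c2 : (-2 : ℝ) < ((b - a : ℤ) : ℝ) := by
      have := g1.2
      have := g2.1
      nlinarith
    have c3 : b - a < 1 := by exact_mod_cast c1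
    have c4 : -2 < b - a := by exact_mod_cast c2
    rcases (by omega : b - a = 0 ∨ b - a = -1) with c5 | c5
    · rw [c5] at e
      simpa using e
    · exfalso
      rw [c5] at e
      push_cast at e
      -- The path `z` raised so as to start at p_k; since z'_k ≥ -p_k, the shift is at most z'_n -
      -- z_n.
      refine hc k hmj hk ⟨fun i => z i + (p k - z k), ⟨?_, ?_⟩, a - 1, ?_⟩
      · intro i hi hin
        have q1 := h.1 i (by omega) hin
        have q2 := h'.1 i (by omega) hin
        have q3 := ih i hi hin
        simp only [mem_Ico] at *
        constructor <;> linarith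
      · intro i hi hin
        obtain ⟨d, hd⟩ := h.2 i (by omega) hin
        exact ⟨d, by simp only [hd]; ring⟩
      · simp only [ha]
        push_cast
        ring

theorem sub_eq_of_uncut (hp : Antitone p) {z z' : ℕ → ℝ} {m n : ℕ} (hmn : m ≤ n)
    (hc : Uncut p m n α) (h : IsPath p α z m n) (h' : IsPath p α z' m n) :
    z' m - z m = z' n - z n := by
  rcases le_total (z n) (z' n) with hle | hle
  · exact sub_eq_of_uncut_of_le hp hc h h' hle le_rfl hmn m le_rfl hmn
  · have := sub_eq_of_uncut_of_le hp hc h' h hle le_rfl hmn m le_rfl hmn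
    linarith

/-- Used to turn a coincidence of interval ends into an arithmetic relation on α, which only
countably many α satisfy. -/
theorem IsPath.sub_mem_closure {z : ℕ → ℝ} {m n : ℕ} (h : IsPath p α z m n) (hmn : m ≤ n) :
    z m + ((n - m : ℕ) : ℝ) * α - z n ∈ AddSubgroup.closure (range p) := by
  induction n, hmn using Nat.le_induction with
  | base => simp
  | succ n hmn ih =>
    have ih := ih (h.mono le_rfl (Nat.le_succ n))
    obtain ⟨a, ha⟩ := h.2 n hmn (Nat.lt_succ_self n)
    have hz : (2 * a) • p n ∈ AddSubgroup.closure (range p) :=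
      AddSubgroup.zsmul_mem _ (AddSubgroup.subset_closure (mem_range_self n)) _
    convert add_mem ih hz using 1
    rw [ha, Nat.sub_add_comm hmn]
    simp only [zsmul_eq_mul]
    push_cast
    ring

theorem exists_unique_of_uncut (hpos : ∀ n, 0 < p n) (hp : Antitone p)
    (hlim : Tendsto p atTop (𝓝 0))
    (hα : ∀ d : ℕ, 0 < d → (d : ℝ) * α ∉ AddSubgroup.closure (range p)) {m : ℕ}
    (hc : ∀ N, ∃ n, N ≤ n ∧ Uncut p m n α) :
    ∃! y, ∀ n, orb p α y n ∈ Ico (-p n) (p n) := by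
  have zmem : ∀ n, (0 : ℝ) ∈ Ico (-p n) (p n) := fun n => ⟨by linarith [hpos n], hpos n⟩
  choose w hw hw0 using fun n => exists_isPath_of_mem (α := α) hpos m n (zmem n)
  set c : ℕ → ℝ := fun n => w n m with hcdef
  -- For uncut n, the points of G_m that reach G_n form the interval c_n + [-p_n, p_n[.
  have key : ∀ n, m ≤ n → Uncut p m n α → ∀ z, IsPath p α z m n → z m = z n + c n := by
    intro n hmn hn z hz
    have := sub_eq_of_uncut hp hmn hn (hw n) hz
    rw [hw0] at this
    simp only [hcdef]
    linarith
  have upper : ∀ n n', m ≤ n → n < n' → Uncut p m n α → Uncut p m n' α →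
      c n' + p n' < c n + p n := by
    intro n n' hm hn h1 h2
    refine lt_of_le_of_ne ?_ ?_
    · refine le_of_forall_lt fun t ht => ?_
      -- The maximum with 0 keeps the height in G_n' even when `t` is far below the interval.
      set u := max (t - c n') 0 with hu
      have hun : u ∈ Ico (-p n') (p n') :=
        ⟨by linarith [le_max_right (t - c n') 0, hpos n'],
          max_lt (by linarith) (hpos n')⟩
      obtain ⟨z, hz, hzu⟩ := exists_isPath_of_mem (α := α) hpos m n' hun
      have k1 := key n' (by omega) h2 z hz
      have k2 := key n hm h1 z (hz.mono le_rfl hn.le)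
      have k3 := (hz.1 n hm hn.le).2
      have k4 := le_max_left (t - c n') 0
      rw [← hu, ← hzu] at k4
      linarith
    -- Equal right ends would mean that the path through the centre of G_n' crosses G_n at p_n -
    -- p_n', so that (n' - n)α lies in the group generated by the heights.
    · intro heq
      have k1 := key n' (by omega) h2 _ (hw n')
      have k2 := key n hm h1 _ ((hw n').mono le_rfl hn.le)
      have k3 := ((hw n').mono hm le_rfl).sub_mem_closure hn.le
      rw [hw0] at k1 k3
      have k4 : w n' n = p n - p n' := by linarith
      refine hα (n' - n) (by omega) ?_
      have k5 : p n - p n' ∈ AddSubgroup.closure (range p) :=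
        sub_mem (AddSubgroup.subset_closure (mem_range_self _))
          (AddSubgroup.subset_closure (mem_range_self _))
      convert sub_mem k3 k5 using 1
      rw [k4]
      ring
  have lower : ∀ n n', m ≤ n → n ≤ n' → Uncut p m n α → Uncut p m n' α →
      c n - p n ≤ c n' - p n' := by
    intro n n' hm hn h1 h2
    obtain ⟨z, hz, hzu⟩ := exists_isPath_of_mem (α := α) hpos m n'
      (u := -p n') ⟨le_rfl, by linarith [hpos n']⟩
    have k1 := key n' (by omega) h2 z hz
    have k2 := key n hm h1 z (hz.mono le_rfl hn)
    have k3 := (hz.1 n hm hn).1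
    linarith
  set S : Set ℝ := (fun n => c n - p n) '' {n | m ≤ n ∧ Uncut p m n α} with hS
  have hSne : S.Nonempty := by
    obtain ⟨n, hn, hn'⟩ := hc m
    exact ⟨_, n, ⟨hn, hn'⟩, rfl⟩
  have hSub : ∀ n, m ≤ n → Uncut p m n α → c n + p n ∈ upperBounds S := by
    rintro n hn hcn _ ⟨n', ⟨hn', hcn'⟩, rfl⟩
    simp only
    rcases le_or_gt n n' with hle | hlt
    · rcases Nat.eq_or_lt_of_le hle with rfl | hlt
      · linarith [hpos n]
      · have := upper n n' hn hlt hcn hcn'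
        linarith [hpos n']
    · have := lower n' n hn' hlt.le hcn' hcn
      linarith [hpos n]
  -- The supremum of the left ends belongs to each half-open interval, because the right ends
  -- strictly decrease.
  set y := sSup S with hy
  have hymem : ∀ n, m ≤ n → Uncut p m n α → y - c n ∈ Ico (-p n) (p n) := by
    intro n hn hcn
    obtain ⟨n', hn', hcn'⟩ := hc (n + 1)
    have h1 : c n - p n ≤ y := le_csSup ⟨_, hSub n hn hcn⟩ ⟨n, ⟨hn, hcn⟩, rfl⟩
    have h2 : y ≤ c n' + p n' := csSup_le hSne (hSub n' (by omega) hcn')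
    have h3 := upper n n' hn (by omega) hcn hcn'
    constructor <;> linarith
  obtain ⟨v, hv1, hv2⟩ := exists_isPath_extend (α := α) hpos m (fun _ => y)
  have hym : y ∈ Ico (-p m) (p m) := by
    obtain ⟨n, hn, hn'⟩ := hc m
    obtain ⟨z, hz, hzu⟩ := exists_isPath_of_mem (α := α) hpos m n (hymem n hn hn')
    have k1 := key n hn hn' z hz
    have : z m = y := by linarith
    rw [← this]
    exact hz.1 m le_rfl hn
  have hv3 : IsPath p α v 0 m := hv2 m ⟨fun i h1 h2 => by
    obtain rfl : i = m := le_antisymm h2 h1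
    exact hym, fun i h1 h2 => by omega⟩
  refine ⟨v 0, fun N => ?_, fun y' hy' => ?_⟩
  · obtain ⟨n, hn, hn'⟩ := hc (max m N)
    have hmn : m ≤ n := (le_max_left _ _).trans hn
    obtain ⟨z, hz, hzu⟩ := exists_isPath_of_mem (α := α) hpos m n (hymem n hmn hn')
    have k1 := key n hmn hn' z hz
    have hzm : z m = v m := by rw [hv1 m le_rfl]; linarith
    -- Concatenation at level m of the backward path from `y` to L and the forward path from `y` to
    -- G_n.
    have hx : IsPath p α (fun i => if i ≤ m then v i else z i) 0 n := by
      constructor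
      · intro i _ hi
        by_cases him : i ≤ m
        · simpa only [if_pos him] using hv3.1 i (Nat.zero_le i) him
        · simpa only [if_neg him] using hz.1 i (by omega) hi
      · intro i _ hi
        by_cases him : i < m
        · simpa only [if_pos him.le, if_pos (Nat.succ_le_of_lt him)] using
            hv3.2 i (Nat.zero_le i) him
        · have e : (if i ≤ m then v i else z i) = z i := by
            split_ifs with h
            · obtain rfl : i = m := by omega
              exact hzm.symm
            · rfl
          simp only [e, if_neg (by omega : ¬ i + 1 ≤ m)]
          exact hz.2 i (by omega) hi
    have hN : N ≤ n := (le_max_right _ _).trans hn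
    have := hx.eq_orb hp N hN
    simp only [Nat.zero_le, if_true] at this
    rw [← this]
    exact hx.1 N (Nat.zero_le _) hN
  · have horb : ∀ n, IsPath p α (orb p α y') 0 n := fun n => isPath_orb fun i _ => hy' i
    -- Both points lie in an interval of length 2 p_n for arbitrarily large n.
    have hm : orb p α y' m = y := by
      by_contra hne
      have hpos' : 0 < |orb p α y' m - y| / 2 := by
        have := abs_pos.2 (sub_ne_zero.2 hne)
        linarith
      obtain ⟨N, hN⟩ := eventually_atTop.1 (hlim.eventually (gt_mem_nhds hpos'))
      obtain ⟨n, hn, hn'⟩ := hc (max m N)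
      have hmn : m ≤ n := (le_max_left _ _).trans hn
      have h1 := key n hmn hn' _ ((horb n).mono (Nat.zero_le m) le_rfl)
      have h2 := hymem n hmn hn'
      have h3 := hy' n
      have h4 := hN n ((le_max_right _ _).trans hn)
      have h5 : |orb p α y' m - y| < 2 * p n := by
        rw [abs_lt]
        simp only [mem_Ico] at *
        constructor <;> linarith
      linarith
    exact (horb m).eq_of_eq hv3 (by rw [hm, hv1 m le_rfl]) le_rfl (Nat.zero_le m)

end Paths

/-! ### Measure of the slopes for which a vertex reaches an aperture. -/

section Measure

variable {p : ℕ → ℝ}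

theorem countable_closure_range (p : ℕ → ℝ) :
    (AddSubgroup.closure (range p) : Set ℝ).Countable := by
  have h : (AddSubgroup.closure (range p) : Set ℝ) =
      range (Finsupp.linearCombination ℤ p) := by
    rw [← LinearMap.coe_range, Finsupp.range_linearCombination,
      ← Submodule.span_int_eq_addSubgroupClosure]
    rfl
  rw [h]
  exact countable_range _

theorem ae_mul_notMem_closure (p : ℕ → ℝ) :
    ∀ᵐ α : ℝ, ∀ d : ℕ, 0 < d → (d : ℝ) * α ∉ AddSubgroup.closure (range p) := by
  rw [ae_all_iff]
  intro d
  by_cases hd : 0 < d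
  · have hc : ((fun x : ℝ => (d : ℝ) * x) ⁻¹' (AddSubgroup.closure (range p) : Set ℝ)).Countable :=
      (countable_closure_range p).preimage (mul_right_injective₀ (by positivity))
    filter_upwards [hc.ae_notMem volume] with α hα _ h
    exact hα h
  · exact Eventually.of_forall fun α h => absurd h hd

/-- For slopes in a bounded interval, the height at which the trajectory from the vertex over `G_k`
passes through `G_(k+1+d)` is one of few affine functions of the slope. -/
theorem exists_finset_vertex (hpos : ∀ n, 0 < p n) (hhalf : ∀ n, p (n + 1) < p n / 2)
    (k : ℕ) (x : ℝ) {r : ℝ} (hr : 0 < r) (d : ℕ) :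
    ∃ C : Finset ℝ, (C.card : ℝ) ≤ 3 ^ d * (r / p k + 2) ∧
      ∀ α ∈ Metric.closedBall x r, ∀ z, IsPath p α z (k + 1) (k + 1 + d) →
        (∃ a : ℤ, z (k + 1) = α - p k - 2 * p k * a) →
        ∃ c ∈ C, z (k + 1 + d) = (d + 1) * α + c := by
  induction d with
  | zero =>
    have hk := hpos k
    set A : ℤ := ⌊(x - r) / (2 * p k)⌋ with hA
    set B : ℤ := ⌊(x + r) / (2 * p k)⌋ with hB
    refine ⟨(Finset.Icc A B).image fun a : ℤ => -p k - 2 * p k * a, ?_, ?_⟩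
    · have h1 : (((Finset.Icc A B).image fun a : ℤ => -p k - 2 * p k * a).card : ℝ) ≤
          ((B + 1 - A).toNat : ℝ) := by
        have := Finset.card_image_le (s := Finset.Icc A B) (f := fun a : ℤ => -p k - 2 * p k * a)
        rw [Int.card_Icc] at this
        exact_mod_cast this
      have hAB : A ≤ B := Int.floor_le_floor (by gcongr; linarith)
      have h2 : ((B + 1 - A).toNat : ℝ) = (B : ℝ) + 1 - A := by
        have : (((B + 1 - A).toNat : ℤ) : ℝ) = ((B + 1 - A : ℤ) : ℝ) := by
          rw [Int.toNat_of_nonneg (by omega)]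
        push_cast at this
        exact this
      have h3 := Int.floor_le ((x + r) / (2 * p k))
      have h4 := Int.lt_floor_add_one ((x - r) / (2 * p k))
      rw [← hB] at h3
      rw [← hA] at h4
      have h5 : (x + r) / (2 * p k) - (x - r) / (2 * p k) = r / p k := by
        field_simp
        ring
      rw [h2] at h1
      simp only [pow_zero, one_mul]
      linarith
    · rintro α hα z hz ⟨a, ha⟩
      refine ⟨-p k - 2 * p k * a, ?_, by simp only [add_zero]; rw [ha]; push_cast; ring⟩
      rw [Metric.mem_closedBall, Real.dist_eq, abs_le] at hα
      have hm := hz.1 (k + 1) le_rfl (by omega)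
      have hs := hhalf k
      rw [ha, mem_Ico] at hm
      obtain ⟨hm1, hm2⟩ := hm
      -- The vertex trajectory must enter G_(k+1), so α determines the number of windings in the
      -- first box.
      have hfl : ⌊α / (2 * p k)⌋ = a := by
        rw [Int.floor_eq_iff, le_div_iff₀ (by positivity), div_lt_iff₀ (by positivity)]
        constructor <;> linarith
      refine Finset.mem_image.2 ⟨a, ?_, rfl⟩
      rw [Finset.mem_Icc, ← hfl]
      constructor
      · exact Int.floor_le_floor (by gcongr; linarith [hα.1])
      · exact Int.floor_le_floor (by gcongr; linarith [hα.2])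
  | succ d ih =>
    obtain ⟨C, hC, hCz⟩ := ih
    set j := k + 1 + d with hj
    have hpj := hpos j
    have hdpos : (0 : ℝ) < d + 1 := by positivity
    -- For fixed c, crossing G_j confines α to an interval of length at most 2 p_j. Then 2 p_j a =
    -- z_j + α - z_(j+1) ranges over a length less than 6 p_j, which leaves three integers a.
    set lo : ℝ → ℤ := fun c =>
      ⌈((-p j - c) / (d + 1) - p j - p (j + 1)) / (2 * p j)⌉ with hlo
    refine ⟨C.biUnion fun c => (Finset.Icc (lo c) (lo c + 2)).image fun a : ℤ => c - 2 * p j * a,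
      ?_, ?_⟩
    · have h1 : (C.biUnion fun c =>
          (Finset.Icc (lo c) (lo c + 2)).image fun a : ℤ => c - 2 * p j * a).card ≤ C.card * 3 := by
        refine Finset.card_biUnion_le_card_mul _ _ _ fun c _ => ?_
        refine Finset.card_image_le.trans ?_
        rw [Int.card_Icc]
        omega
      have h2 : ((C.biUnion fun c => (Finset.Icc (lo c) (lo c + 2)).image
          fun a : ℤ => c - 2 * p j * a).card : ℝ) ≤ C.card * 3 := by exact_mod_cast h1
      rw [pow_succ]
      linarith
    · intro α hα z hz hza
      obtain ⟨c, hc, hzc⟩ := hCz α hα z (hz.mono le_rfl (by omega)) hza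
      obtain ⟨a, ha⟩ := hz.2 j (by omega) (by omega)
      have m1 := hz.1 j (by omega) (by omega)
      have m2 := hz.1 (j + 1) (by omega) (by omega)
      have hs := hhalf j
      refine ⟨c - 2 * p j * a, ?_, ?_⟩
      swap
      · rw [show k + 1 + (d + 1) = j + 1 by omega, ha, hzc]
        push_cast
        ring
      refine Finset.mem_biUnion.2 ⟨c, hc, Finset.mem_image.2 ⟨a, ?_, rfl⟩⟩
      rw [ha, hzc, mem_Ico] at m2
      rw [hzc, mem_Ico] at m1
      obtain ⟨m11, m12⟩ := m1
      obtain ⟨m21, m22⟩ := m2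
      set T : ℝ := (-p j - c) / (d + 1) with hT
      have hTd : T * (d + 1) = -p j - c := by
        rw [hT]
        field_simp
      have t1 : T ≤ α := by
        rw [hT, div_le_iff₀ hdpos]
        linarith
      have t2 : α < T + 2 * p j := by
        have h0 : (α - T) * (d + 1) < 2 * p j := by linarith
        have h1 : (0 : ℝ) ≤ d := by positivity
        nlinarith
      rw [Finset.mem_Icc]
      constructor
      · simp only [hlo]
        rw [Int.ceil_le, div_le_iff₀ (by positivity)]
        linarith
      · have hle := Int.le_ceil ((T - p j - p (j + 1)) / (2 * p j))
        rw [div_le_iff₀ (by positivity)] at hle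
        have : (a : ℝ) < (lo c : ℝ) + 3 := by
          simp only [hlo]
          have : (a : ℝ) * (2 * p j) <
              (⌈(T - p j - p (j + 1)) / (2 * p j)⌉ + 3 : ℝ) * (2 * p j) := by
            linarith
          exact lt_of_mul_lt_mul_right this (by positivity)
        have : a < lo c + 3 := by exact_mod_cast this
        omega

/-- Each affine function (d+1)α + c takes values in [-p_n, p_n] on an interval of length 2
p_n/(d+1). -/
theorem volume_vertexReaches_le (hpos : ∀ n, 0 < p n) (hhalf : ∀ n, p (n + 1) < p n / 2)
    (k : ℕ) (x : ℝ) {r : ℝ} (hr : 0 < r) (d : ℕ) :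
    volume ({α | VertexReaches p k (k + 1 + d) α} ∩ Metric.closedBall x r) ≤
      ENNReal.ofReal (3 ^ d * (r / p k + 2) * (2 * p (k + 1 + d) / (d + 1))) := by
  obtain ⟨C, hC, hCz⟩ := exists_finset_vertex hpos hhalf k x hr d
  set n := k + 1 + d with hn
  have hdpos : (0 : ℝ) < d + 1 := by positivity
  have hsub : {α | VertexReaches p k n α} ∩ Metric.closedBall x r ⊆
      ⋃ c ∈ C, Icc ((-p n - c) / (d + 1)) ((p n - c) / (d + 1)) := by
    rintro α ⟨⟨z, hz, hza⟩, hα⟩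
    obtain ⟨c, hc, hzc⟩ := hCz α hα z hz hza
    have hm := hz.1 n (by omega) le_rfl
    rw [hzc, mem_Ico] at hm
    refine mem_iUnion₂.2 ⟨c, hc, ?_, ?_⟩
    · rw [div_le_iff₀ hdpos]
      linarith [hm.1]
    · rw [le_div_iff₀ hdpos]
      linarith [hm.2]
  refine (measure_mono hsub).trans ((measure_biUnion_finset_le _ _).trans ?_)
  have hpn := hpos n
  have hvol : ∀ c ∈ C, volume (Icc ((-p n - c) / (d + 1 : ℝ)) ((p n - c) / (d + 1))) =
      ENNReal.ofReal (2 * p n / (d + 1)) := fun c _ => by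
    rw [Real.volume_Icc]
    congr 1
    ring
  rw [Finset.sum_congr rfl hvol, Finset.sum_const, nsmul_eq_mul, ← ENNReal.ofReal_natCast,
    ← ENNReal.ofReal_mul (by positivity)]
  exact ENNReal.ofReal_le_ofReal (by gcongr)

/-- The full series is -log(1 - 3λ)/3, which is at most log 2. -/
theorem sum_three_pow_le {lam : ℝ} (h0 : 0 < lam) (h1 : lam < 29 / 100) (N : ℕ) :
    ∑ d ∈ Finset.range N, 3 ^ d * lam ^ (d + 1) / (d + 1) ≤ 7 / 10 := by
  have habs : |3 * lam| < 1 := by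
    rw [abs_of_pos (by positivity)]
    linarith
  have hs := Real.hasSum_pow_div_log_of_abs_lt_one habs
  have hle := sum_le_hasSum (Finset.range N) (fun i _ => by positivity) hs
  -- Here 1 - 3λ > 0.13 > 1/8.
  have hlog : -Real.log (1 - 3 * lam) ≤ 3 * Real.log 2 := by
    rw [← Real.log_inv, show (3 : ℝ) * Real.log 2 = Real.log (2 ^ 3) by
      rw [Real.log_pow]; norm_num]
    refine Real.log_le_log (inv_pos.2 (by linarith)) ?_
    rw [inv_le_comm₀ (by linarith) (by positivity)]
    norm_num
    linarith
  have hl2 := Real.log_two_lt_d9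
  have heq : ∑ d ∈ Finset.range N, (3 : ℝ) ^ d * lam ^ (d + 1) / (d + 1) =
      (∑ d ∈ Finset.range N, (3 * lam) ^ (d + 1) / ((d : ℝ) + 1)) / 3 := by
    rw [Finset.sum_div]
    refine Finset.sum_congr rfl fun d _ => ?_
    rw [mul_pow, pow_succ 3 d]
    field_simp
  rw [heq]
  linarith

theorem le_pow_mul_of_le {lam : ℝ} (h0 : 0 < lam) (hle : ∀ n, p (n + 1) ≤ lam * p n) (k d : ℕ) :
    p (k + d) ≤ lam ^ d * p k := by
  induction d with
  | zero => simp
  | succ d ih =>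
    calc p (k + (d + 1)) ≤ lam * p (k + d) := hle _
      _ ≤ lam * (lam ^ d * p k) := by gcongr
      _ = lam ^ (d + 1) * p k := by ring

/-- Union bound over the vertices k = n - 1 - d. The decay p_n ≤ λ^(d+1) p_k cancels the factor
1/p_k in the number of branches. -/
theorem volume_not_uncut_le (hpos : ∀ n, 0 < p n) (hp : Antitone p) {lam : ℝ} (h0 : 0 < lam)
    (h1 : lam < 29 / 100) (hle : ∀ n, p (n + 1) ≤ lam * p n) (m n : ℕ) (x : ℝ) {r : ℝ}
    (hr : 0 < r) :
    volume ({α | ¬ Uncut p m n α} ∩ Metric.closedBall x r) ≤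
      ENNReal.ofReal (7 / 10 * (2 * r + 4 * p m)) := by
  have hhalf : ∀ n, p (n + 1) < p n / 2 := fun n => by nlinarith [hle n, hpos n]
  have hsub : {α | ¬ Uncut p m n α} ∩ Metric.closedBall x r ⊆
      ⋃ d ∈ Finset.range (n - m), {α | VertexReaches p (n - 1 - d) n α} ∩
        Metric.closedBall x r := by
    rintro α ⟨hα, hx⟩
    simp only [Uncut, mem_ofPred_eq, not_forall, not_not] at hα
    obtain ⟨k, hk, hkn, hv⟩ := hα
    refine mem_iUnion₂.2 ⟨n - 1 - k, Finset.mem_range.2 (by omega), ?_, hx⟩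
    rw [mem_ofPred_eq, show n - 1 - (n - 1 - k) = k by omega]
    exact hv
  refine (measure_mono hsub).trans ((measure_biUnion_finset_le _ _).trans ?_)
  have hterm : ∀ d ∈ Finset.range (n - m),
      volume ({α | VertexReaches p (n - 1 - d) n α} ∩ Metric.closedBall x r) ≤
        ENNReal.ofReal (3 ^ d * lam ^ (d + 1) / (d + 1) * (2 * r + 4 * p m)) := by
    intro d hd
    rw [Finset.mem_range] at hd
    have hv := volume_vertexReaches_le hpos hhalf (n - 1 - d) x hr d
    rw [show n - 1 - d + 1 + d = n by omega] at hv
    refine hv.trans (ENNReal.ofReal_le_ofReal ?_)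
    set k := n - 1 - d with hk
    have hpk := hpos k
    have hkm : p k ≤ p m := hp (by omega)
    have hpn : p n ≤ lam ^ (d + 1) * p k := by
      have := le_pow_mul_of_le h0 hle k (d + 1)
      rwa [show k + (d + 1) = n by omega] at this
    calc (3 : ℝ) ^ d * (r / p k + 2) * (2 * p n / (d + 1))
        ≤ 3 ^ d * (r / p k + 2) * (2 * (lam ^ (d + 1) * p k) / (d + 1)) := by gcongr
      _ = 3 ^ d * lam ^ (d + 1) / (d + 1) * (2 * r + 4 * p k) := by
        field_simp
        ring
      _ ≤ _ := by gcongr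
  refine (Finset.sum_le_sum hterm).trans ?_
  have hpm := hpos m
  rw [← ENNReal.ofReal_sum_of_nonneg fun d _ => by positivity, ← Finset.sum_mul]
  refine ENNReal.ofReal_le_ofReal ?_
  gcongr
  exact sum_three_pow_le h0 h1 _

/-- Almost every point of a set is a point of density 1, even if the set is not measurable. -/
theorem measure_eq_zero_of_inter_closedBall_le {s : Set ℝ} {c : ENNReal} (hc : c < 1)
    (h : ∀ x r, 0 < r → volume (s ∩ Metric.closedBall x r) ≤ c * volume (Metric.closedBall x r)) :
    volume s = 0 := by
  have hs := Besicovitch.ae_tendsto_measure_inter_div (volume : Measure ℝ) s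
  have hF : ∀ᵐ x ∂(volume.restrict s), False := by
    filter_upwards [hs] with x hx
    refine absurd (le_of_tendsto hx ?_) (not_le.2 hc)
    filter_upwards [self_mem_nhdsWithin] with r hr
    exact ENNReal.div_le_of_le_mul (h x r hr)
  rw [← Measure.restrict_eq_zero]
  exact ae_eq_bot.1 (eventually_false_iff_eq_bot.1 hF)

theorem ae_exists_frequently_uncut (hpos : ∀ n, 0 < p n) (hp : Antitone p)
    (hlim : Tendsto p atTop (𝓝 0)) {lam : ℝ} (h0 : 0 < lam)
    (h1 : lam < 29 / 100) (hle : ∀ n, p (n + 1) ≤ lam * p n) :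
    ∀ᵐ α : ℝ, ∃ m, ∀ N, ∃ n, N ≤ n ∧ Uncut p m n α := by
  refine measure_eq_zero_of_inter_closedBall_le (c := ENNReal.ofReal (9 / 10)) (by norm_num) ?_
  intro x r hr
  -- With p_m < r/10 the bound is below 7/10 · 2.4 r = 1.68 r, less than 9/10 of the length 2r.
  obtain ⟨m, hm⟩ := (hlim.eventually (gt_mem_nhds (by positivity : 0 < r / 10))).exists
  set T : ℕ → Set ℝ := fun N => {α | ∀ n, N ≤ n → ¬ Uncut p m n α} ∩ Metric.closedBall x r
    with hT
  have hmono : Monotone T := fun N N' h α hα => ⟨fun n hn => hα.1 n (h.trans hn), hα.2⟩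
  have hsub : {α | ∃ m, ∀ N, ∃ n, N ≤ n ∧ Uncut p m n α}ᶜ ∩ Metric.closedBall x r ⊆
      ⋃ N, T N := by
    rintro α ⟨hα, hx⟩
    simp only [mem_compl_iff, mem_ofPred_eq, not_exists, not_forall, not_and] at hα
    obtain ⟨N, hN⟩ := hα m
    exact mem_iUnion.2 ⟨N, hN, hx⟩
  refine (measure_mono hsub).trans ?_
  rw [hmono.measure_iUnion]
  refine iSup_le fun N => ?_
  have : T N ⊆ {α | ¬ Uncut p m N α} ∩ Metric.closedBall x r := fun α hα => ⟨hα.1 N le_rfl, hα.2⟩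
  refine (measure_mono this).trans ((volume_not_uncut_le hpos hp h0 h1 hle m N x hr).trans ?_)
  rw [Real.volume_closedBall, ← ENNReal.ofReal_mul (by norm_num)]
  exact ENNReal.ofReal_le_ofReal (by linarith)

theorem ae_existsUnique_orb (hpos : ∀ n, 0 < p n) (hp : Antitone p)
    (hlim : Tendsto p atTop (𝓝 0)) {lam : ℝ} (h0 : 0 < lam)
    (h1 : lam < 29 / 100) (hle : ∀ n, p (n + 1) ≤ lam * p n) :
    ∀ᵐ α : ℝ, ∃! y, ∀ n, orb p α y n ∈ Ico (-p n) (p n) := by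
  filter_upwards [ae_mul_notMem_closure p, ae_exists_frequently_uncut hpos hp hlim h0 h1 hle]
    with α h2 ⟨m, hm⟩
  exact exists_unique_of_uncut hpos hp hlim h2 hm

end Measure

/-! ### The return map to integer abscissas and the flow built from it. -/

section Dynamics

variable (P : StepBilliard)

theorem halfWidth_natCast (n : ℕ) : P.halfWidth n = P.p n := by simp [halfWidth]

theorem halfWidth_neg_succ (n : ℕ) : P.halfWidth (-((n : ℤ) + 1)) = P.p n := by
  rw [halfWidth, if_neg (by omega)]
  congr 1
  omega

theorem halfWidth_pos (k : ℤ) : 0 < P.halfWidth k := by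
  unfold halfWidth
  split_ifs <;> exact P.p_pos _

theorem eq_natCast_or_eq_neg_succ (k : ℤ) : ∃ n : ℕ, k = n ∨ k = -((n : ℤ) + 1) := by
  rcases le_or_gt 0 k with h | h
  · exact ⟨k.toNat, Or.inl (by omega)⟩
  · exact ⟨(-k - 1).toNat, Or.inr (by omega)⟩

/-- The points of the surface with integer abscissa. -/
abbrev Section : Type := {q : ℤ × ℝ // q.2 ∈ Ico (-P.halfWidth q.1) (P.halfWidth q.1)}

variable {P} in
/-- A point of the section, as a point of the plane. -/
def Section.toPlane (q : P.Section) : ℝ × ℝ := ((q.1.1 : ℝ), q.1.2)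

variable {P} in
theorem Section.toPlane_injective : Function.Injective (Section.toPlane (P := P)) := by
  rintro ⟨⟨k, y⟩, h⟩ ⟨⟨k', y'⟩, h'⟩ heq
  simpa [Section.toPlane] using heq

/-- `glue`, with an integer abscissa. -/
noncomputable def intGlue (k : ℤ) (y : ℝ) : ℤ × ℝ :=
  if 0 < k ∧ ¬ (-P.p k.toNat ≤ y ∧ y < P.p k.toNat) then (-k, y) else (k, y)

theorem glue_eq (k : ℤ) (y : ℝ) :
    P.glue k y = (((P.intGlue k y).1 : ℝ), (P.intGlue k y).2) := by
  unfold glue intGlue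
  split_ifs <;> simp

theorem intGlue_natCast_of_mem {n : ℕ} {y : ℝ} (h : y ∈ Ico (-P.p (n + 1)) (P.p (n + 1))) :
    P.intGlue ((n : ℤ) + 1) y = ((n : ℤ) + 1, y) := by
  have e : ((n : ℤ) + 1).toNat = n + 1 := by omega
  rw [intGlue, if_neg]
  rw [e]
  exact fun h' => h'.2 h

theorem intGlue_natCast_of_notMem {n : ℕ} {y : ℝ}
    (h : y ∉ Ico (-P.p (n + 1)) (P.p (n + 1))) :
    P.intGlue ((n : ℤ) + 1) y = (-((n : ℤ) + 1), y) := by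
  have e : ((n : ℤ) + 1).toNat = n + 1 := by omega
  rw [intGlue, if_pos]
  rw [e]
  exact ⟨by omega, h⟩

theorem intGlue_neg (n : ℕ) (y : ℝ) : P.intGlue (-((n : ℤ) + 1) + 1) y = (-(n : ℤ), y) := by
  rw [intGlue, if_neg (by omega)]
  congr 1
  omega

theorem intGlue_mem {k : ℤ} {y : ℝ} (hy : y ∈ Ico (-P.halfWidth k) (P.halfWidth k)) :
    (P.intGlue (k + 1) y).2 ∈ Ico (-P.halfWidth (P.intGlue (k + 1) y).1)
      (P.halfWidth (P.intGlue (k + 1) y).1) := by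
  obtain ⟨n, rfl | rfl⟩ := eq_natCast_or_eq_neg_succ k
  · by_cases h : y ∈ Ico (-P.p (n + 1)) (P.p (n + 1))
    · rw [P.intGlue_natCast_of_mem h]
      have e := P.halfWidth_natCast (n + 1)
      push_cast at e
      simpa only [e] using h
    · rw [P.intGlue_natCast_of_notMem h]
      simpa only [halfWidth_neg_succ, halfWidth_natCast] using hy
  · rw [P.intGlue_neg]
    rw [halfWidth_neg_succ] at hy
    rcases n with _ | n
    · have e := P.halfWidth_natCast 0
      push_cast at e
      simpa [e] using hy
    · have e := P.halfWidth_neg_succ n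
      have h := P.p_antitone (Nat.le_succ n)
      push_cast
      simp only [e]
      exact ⟨by linarith [hy.1], by linarith [hy.2]⟩

/-- The first return map to the section. -/
noncomputable def returnMap (α : ℝ) (q : P.Section) : P.Section :=
  ⟨P.intGlue (q.1.1 + 1) (wrap (P.halfWidth q.1.1) (q.1.2 + α)),
    P.intGlue_mem (wrap_mem (P.halfWidth_pos _) _)⟩

theorem wrap_add_inj {h α y y' : ℝ} (hy : y ∈ Ico (-h) h) (hy' : y' ∈ Ico (-h) h)
    (heq : wrap h (y + α) = wrap h (y' + α)) : y = y' := by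
  obtain ⟨a, ha⟩ := wrap_eq h (y + α)
  obtain ⟨b, hb⟩ := wrap_eq h (y' + α)
  refine eq_of_sub_eq_mul hy hy' (a := a - b) ?_
  push_cast
  linarith

theorem exists_wrap_add_eq {h w : ℝ} (α : ℝ) (hw : w ∈ Ico (-h) h) :
    ∃ y ∈ Ico (-h) h, wrap h (y + α) = w := by
  have hh : 0 < h := by linarith [hw.1, hw.2]
  obtain ⟨a, ha⟩ := wrap_eq h (w - α)
  refine ⟨wrap h (w - α), wrap_mem hh _, wrap_unique hw (a := -a) ?_⟩
  rw [ha]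
  push_cast
  ring

/-- Abscissa -k, k ≥ 1, is entered by collision from strip k-1 and by free passage from strip
-(k+1). The heights are outside [-p_k, p_k[ in the first case and inside it in the second. -/
theorem intGlue_inj {k k' : ℤ} {y y' : ℝ} (hy : y ∈ Ico (-P.halfWidth k) (P.halfWidth k))
    (hy' : y' ∈ Ico (-P.halfWidth k') (P.halfWidth k'))
    (h : P.intGlue (k + 1) y = P.intGlue (k' + 1) y') : k = k' ∧ y = y' := by
  obtain ⟨n, rfl | rfl⟩ := eq_natCast_or_eq_neg_succ k <;>
  obtain ⟨n', rfl | rfl⟩ := eq_natCast_or_eq_neg_succ k'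
  · by_cases h1 : y ∈ Ico (-P.p (n + 1)) (P.p (n + 1)) <;>
    by_cases h2 : y' ∈ Ico (-P.p (n' + 1)) (P.p (n' + 1)) <;>
    simp only [P.intGlue_natCast_of_mem, P.intGlue_natCast_of_notMem, h1, h2, not_false_eq_true,
      Prod.mk.injEq] at h <;>
    exact ⟨by omega, h.2⟩
  · by_cases h1 : y ∈ Ico (-P.p (n + 1)) (P.p (n + 1))
    · rw [P.intGlue_natCast_of_mem h1, P.intGlue_neg, Prod.mk.injEq] at h
      omega
    · rw [P.intGlue_natCast_of_notMem h1, P.intGlue_neg, Prod.mk.injEq] at h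
      obtain ⟨ha, rfl⟩ := h
      obtain rfl : n' = n + 1 := by omega
      rw [halfWidth_neg_succ] at hy'
      exact absurd hy' h1
  · by_cases h1 : y' ∈ Ico (-P.p (n' + 1)) (P.p (n' + 1))
    · rw [P.intGlue_natCast_of_mem h1, P.intGlue_neg, Prod.mk.injEq] at h
      omega
    · rw [P.intGlue_natCast_of_notMem h1, P.intGlue_neg, Prod.mk.injEq] at h
      obtain ⟨ha, rfl⟩ := h
      obtain rfl : n = n' + 1 := by omega
      rw [halfWidth_neg_succ] at hy
      exact absurd hy h1
  · rw [P.intGlue_neg, P.intGlue_neg, Prod.mk.injEq] at h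
    exact ⟨by omega, h.2⟩

theorem exists_intGlue_eq {j : ℤ} {w : ℝ} (hw : w ∈ Ico (-P.halfWidth j) (P.halfWidth j)) :
    ∃ k : ℤ, w ∈ Ico (-P.halfWidth k) (P.halfWidth k) ∧ P.intGlue (k + 1) w = (j, w) := by
  obtain ⟨n, rfl | rfl⟩ := eq_natCast_or_eq_neg_succ j
  · rcases n with _ | n
    · refine ⟨-(((0 : ℕ) : ℤ) + 1), ?_, by rw [P.intGlue_neg]; rfl⟩
      rw [halfWidth_neg_succ]
      rwa [halfWidth_natCast] at hw
    · refine ⟨n, ?_, ?_⟩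
      · rw [halfWidth_natCast] at hw ⊢
        have h := P.p_antitone (Nat.le_succ n)
        exact ⟨by linarith [hw.1], by linarith [hw.2]⟩
      · rw [halfWidth_natCast] at hw
        rw [P.intGlue_natCast_of_mem hw]
        push_cast
        rfl
  · by_cases h : w ∈ Ico (-P.p (n + 1)) (P.p (n + 1))
    · refine ⟨-(((n + 1 : ℕ) : ℤ) + 1), ?_, ?_⟩
      · rwa [halfWidth_neg_succ]
      · rw [P.intGlue_neg]
        push_cast
        rfl
    · refine ⟨n, ?_, P.intGlue_natCast_of_notMem h⟩
      rwa [halfWidth_neg_succ] at hw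

/-- Invertibility lets the flow be defined for negative times as well. -/
theorem returnMap_bijective (α : ℝ) : Function.Bijective (P.returnMap α) := by
  constructor
  · rintro ⟨⟨k, y⟩, hy⟩ ⟨⟨k', y'⟩, hy'⟩ h
    simp only [returnMap, Subtype.mk.injEq] at h hy hy'
    obtain ⟨rfl, h2⟩ := P.intGlue_inj (wrap_mem (P.halfWidth_pos _) _)
      (wrap_mem (P.halfWidth_pos _) _) h
    obtain rfl := wrap_add_inj hy hy' h2
    rfl
  · rintro ⟨⟨j, w⟩, hw⟩
    obtain ⟨k, hk, hkw⟩ := P.exists_intGlue_eq hw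
    obtain ⟨y, hy, hyw⟩ := exists_wrap_add_eq α hk
    refine ⟨⟨(k, y), hy⟩, ?_⟩
    simp only [returnMap, Subtype.mk.injEq]
    rw [hyw, hkw]

/-- The first return map, as a permutation of the section. -/
noncomputable def returnPerm (α : ℝ) : Equiv.Perm P.Section :=
  Equiv.ofBijective _ (P.returnMap_bijective α)

theorem returnPerm_apply (α : ℝ) (q : P.Section) : P.returnPerm α q = P.returnMap α q := rfl

theorem returnPerm_zpow_succ (α : ℝ) (n : ℤ) (q : P.Section) :
    (P.returnPerm α ^ (n + 1)) q = P.returnMap α ((P.returnPerm α ^ n) q) := by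
  rw [add_comm, zpow_add, zpow_one, Equiv.Perm.mul_apply, returnPerm_apply]

/-- The trajectory through the point `q` of the section. -/
noncomputable def flow (θ : ℝ) (q : P.Section) (t : ℝ) : ℝ × ℝ :=
  let r := ((P.returnPerm (Real.tan θ) ^ ⌊t * Real.cos θ⌋) q).1
  (r.1 + Int.fract (t * Real.cos θ),
    wrap (P.halfWidth r.1) (r.2 + Int.fract (t * Real.cos θ) * Real.tan θ))

theorem floor_flow_fst (θ : ℝ) (q : P.Section) (t : ℝ) :
    ⌊(P.flow θ q t).1⌋ = ((P.returnPerm (Real.tan θ) ^ ⌊t * Real.cos θ⌋) q).1.1 := by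
  simp [flow]

theorem flow_of_fract_eq_zero {θ : ℝ} (q : P.Section) {t : ℝ}
    (h : Int.fract (t * Real.cos θ) = 0) :
    P.flow θ q t = ((P.returnPerm (Real.tan θ) ^ ⌊t * Real.cos θ⌋) q).toPlane := by
  have := ((P.returnPerm (Real.tan θ) ^ ⌊t * Real.cos θ⌋) q).2
  simp only [flow, h, Section.toPlane, add_zero, zero_mul, wrap_of_mem this]

theorem returnMap_toPlane (α : ℝ) (q : P.Section) :
    (P.returnMap α q).toPlane =
      P.glue (q.1.1 + 1) (wrap (P.halfWidth q.1.1) (q.1.2 + α)) := by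
  rw [glue_eq]
  rfl

theorem isTrajectory_flow {θ : ℝ} (hθ : 0 < Real.cos θ) (q : P.Section) :
    P.IsTrajectory θ (P.flow θ q) := by
  have hsin : ∀ s : ℝ, s * Real.sin θ = s * Real.cos θ * Real.tan θ := fun s => by
    rw [mul_assoc, mul_comm (Real.cos θ), Real.tan_mul_cos hθ.ne']
  refine ⟨fun t => ?_, fun t s hs h => ?_, fun t s hs h => ?_⟩
  · rw [surface, mem_ofPred_eq, floor_flow_fst]
    exact wrap_mem (P.halfWidth_pos _) _
  · rw [floor_flow_fst] at h ⊢
    set n := ⌊t * Real.cos θ⌋ with hn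
    set r := (P.returnPerm (Real.tan θ) ^ n) q with hr
    have hX : (P.flow θ q t).1 = r.1.1 + Int.fract (t * Real.cos θ) := rfl
    have hY : (P.flow θ q t).2 = wrap (P.halfWidth r.1.1)
      (r.1.2 + Int.fract (t * Real.cos θ) * Real.tan θ) := rfl
    rw [hX] at h
    have hf0 := Int.fract_nonneg (t * Real.cos θ)
    have hs0 : 0 ≤ s * Real.cos θ := by positivity
    have htn := Int.floor_add_fract (t * Real.cos θ)
    rw [← hn] at htn
    have hfl : ⌊(t + s) * Real.cos θ⌋ = n := by
      rw [Int.floor_eq_iff]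
      constructor <;> linarith
    have hfr : Int.fract ((t + s) * Real.cos θ) = Int.fract (t * Real.cos θ) + s * Real.cos θ := by
      have := Int.floor_add_fract ((t + s) * Real.cos θ)
      rw [hfl] at this
      linarith
    have hgoal : P.flow θ q (t + s) = (r.1.1 + Int.fract ((t + s) * Real.cos θ),
        wrap (P.halfWidth r.1.1) (r.1.2 + Int.fract ((t + s) * Real.cos θ) * Real.tan θ)) := by
      rw [hr, ← hfl]
      rfl
    rw [hgoal, hX, hY, wrap_wrap_add (P.halfWidth_pos _), hfr, hsin]
    refine Prod.ext (by ring) ?_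
    simp only
    congr 1
    ring
  · rw [floor_flow_fst] at h ⊢
    set n := ⌊t * Real.cos θ⌋ with hn
    set r := (P.returnPerm (Real.tan θ) ^ n) q with hr
    have hX : (P.flow θ q t).1 = r.1.1 + Int.fract (t * Real.cos θ) := rfl
    have hY : (P.flow θ q t).2 = wrap (P.halfWidth r.1.1)
      (r.1.2 + Int.fract (t * Real.cos θ) * Real.tan θ) := rfl
    rw [hX] at h
    have htn := Int.floor_add_fract (t * Real.cos θ)
    rw [← hn] at htn
    have hts : (t + s) * Real.cos θ = ((n + 1 : ℤ) : ℝ) := by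
      push_cast
      linarith
    rw [P.flow_of_fract_eq_zero q (by rw [hts, Int.fract_intCast]), hts, Int.floor_intCast,
      returnPerm_zpow_succ, returnMap_toPlane, hY, wrap_wrap_add (P.halfWidth_pos _), hsin]
    congr 2
    have : s * Real.cos θ = 1 - Int.fract (t * Real.cos θ) := by linarith
    rw [this]
    ring

/-! ### Trajectories are determined by one point of the section. -/

variable {P}

namespace IsTrajectory

variable {θ : ℝ} {γ : ℝ → ℝ × ℝ}

theorem exists_section (h : P.IsTrajectory θ γ) (hθ : 0 < Real.cos θ) (t : ℝ) :
    ∃ q : P.Section, γ (t + (1 - Int.fract (γ t).1) / Real.cos θ) = q.toPlane := by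
  have hf := Int.fract_lt_one (γ t).1
  have hc := h.crossing t ((1 - Int.fract (γ t).1) / Real.cos θ)
    (div_nonneg (by linarith) hθ.le) (by
      rw [div_mul_cancel₀ _ hθ.ne']
      linarith [Int.floor_add_fract (γ t).1])
  rw [glue_eq] at hc
  exact ⟨⟨_, P.intGlue_mem (wrap_mem (P.halfWidth_pos _) _)⟩, hc⟩

theorem next (h : P.IsTrajectory θ γ) (hθ : 0 < Real.cos θ) {t : ℝ} {q : P.Section}
    (hq : γ t = q.toPlane) :
    γ (t + 1 / Real.cos θ) = (P.returnMap (Real.tan θ) q).toPlane := by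
  have hX : (γ t).1 = q.1.1 := by rw [hq]; rfl
  have hY : (γ t).2 = q.1.2 := by rw [hq]; rfl
  rw [h.crossing t (1 / Real.cos θ) (by positivity) (by
    rw [div_mul_cancel₀ _ hθ.ne', hX, Int.floor_intCast]), hX, hY, Int.floor_intCast,
    returnMap_toPlane, Real.tan_eq_sin_div_cos, one_div_mul_eq_div]

/-- The laws of motion only run forwards; the past is recovered because the return map has a single
preimage. -/
theorem prev (h : P.IsTrajectory θ γ) (hθ : 0 < Real.cos θ) {t : ℝ} {q : P.Section}
    (hq : γ (t + 1 / Real.cos θ) = q.toPlane) :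
    ∃ q' : P.Section, γ t = q'.toPlane ∧ P.returnMap (Real.tan θ) q' = q := by
  have hf0 := Int.fract_nonneg (γ t).1
  have hf1 := Int.fract_lt_one (γ t).1
  -- From the next integer abscissa, the motion during the remaining time adds exactly this
  -- fractional part to X, and ends at an integer.
  have hf : Int.fract (γ t).1 = 0 := by
    obtain ⟨r, hr⟩ := h.exists_section hθ t
    set s := (1 - Int.fract (γ t).1) / Real.cos θ with hs
    have hX : (γ (t + s)).1 = r.1.1 := by rw [hr]; rfl
    have hin := h.inside (t + s) (Int.fract (γ t).1 / Real.cos θ) (by positivity) (by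
      rw [div_mul_cancel₀ _ hθ.ne', hX, Int.floor_intCast]
      linarith)
    rw [show t + s + Int.fract (γ t).1 / Real.cos θ = t + 1 / Real.cos θ by rw [hs]; ring,
      hq, div_mul_cancel₀ _ hθ.ne', hX] at hin
    have h1 : (q.1.1 : ℝ) = r.1.1 + Int.fract (γ t).1 := congrArg Prod.fst hin
    have h2 : Int.fract (Int.fract (γ t).1) = 0 := by
      rw [show Int.fract (γ t).1 = ((q.1.1 - r.1.1 : ℤ) : ℝ) by push_cast; linarith,
        Int.fract_intCast]
    rwa [Int.fract_fract] at h2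
  have hX : (γ t).1 = (⌊(γ t).1⌋ : ℝ) := by linarith [Int.floor_add_fract (γ t).1]
  have hmem := h.mem_surface t
  refine ⟨⟨(⌊(γ t).1⌋, (γ t).2), hmem⟩, Prod.ext hX rfl, ?_⟩
  have := h.next hθ (t := t) (q := ⟨(⌊(γ t).1⌋, (γ t).2), hmem⟩) (Prod.ext hX rfl)
  exact Section.toPlane_injective (this.symm.trans hq)

theorem eq_zpow (h : P.IsTrajectory θ γ) (hθ : 0 < Real.cos θ) {t : ℝ} {q : P.Section}
    (hq : γ t = q.toPlane) (n : ℤ) :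
    γ (t + n / Real.cos θ) = ((P.returnPerm (Real.tan θ) ^ n) q).toPlane := by
  induction n using Int.induction_on with
  | zero => simpa using hq
  | succ n ih =>
    have := h.next hθ ih
    rw [returnPerm_zpow_succ, ← this]
    congr 1
    push_cast
    ring
  | pred n ih =>
    have e : t + ((-(n : ℤ) : ℤ) : ℝ) / Real.cos θ =
        t + ((-(n : ℤ) - 1 : ℤ) : ℝ) / Real.cos θ + 1 / Real.cos θ := by
      push_cast
      ring
    rw [e] at ih
    obtain ⟨q', hq', hr⟩ := h.prev hθ ih
    rw [hq']
    congr 1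
    apply (P.returnPerm (Real.tan θ)).injective
    rw [returnPerm_apply, returnPerm_apply, hr, ← returnPerm_zpow_succ]
    congr 2
    ring

theorem eq_flow (h : P.IsTrajectory θ γ) (hθ : 0 < Real.cos θ) {t : ℝ} {q : P.Section}
    (hq : γ t = q.toPlane) (s : ℝ) : γ (t + s) = P.flow θ q s := by
  set n := ⌊s * Real.cos θ⌋ with hn
  set r := (P.returnPerm (Real.tan θ) ^ n) q with hr
  have hz : γ (t + n / Real.cos θ) = r.toPlane := h.eq_zpow hθ hq n
  have hX : (γ (t + n / Real.cos θ)).1 = r.1.1 := by rw [hz]; rfl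
  have hY : (γ (t + n / Real.cos θ)).2 = r.1.2 := by rw [hz]; rfl
  have hf0 := Int.fract_nonneg (s * Real.cos θ)
  have hf1 := Int.fract_lt_one (s * Real.cos θ)
  have hfn := Int.floor_add_fract (s * Real.cos θ)
  have hin := h.inside (t + n / Real.cos θ) (Int.fract (s * Real.cos θ) / Real.cos θ)
    (by positivity) (by
      rw [div_mul_cancel₀ _ hθ.ne', hX, Int.floor_intCast]
      linarith)
  have e : t + n / Real.cos θ + Int.fract (s * Real.cos θ) / Real.cos θ = t + s := by
    rw [add_assoc, ← add_div, hn, hfn, mul_div_cancel_right₀ _ hθ.ne']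
  rw [e, hX, hY, Int.floor_intCast, div_mul_cancel₀ _ hθ.ne', div_mul_eq_mul_div, mul_div_assoc,
    ← Real.tan_eq_sin_div_cos] at hin
  exact hin

end IsTrajectory

/-! ### Escaping points of L and escape orbits. -/

theorem returnMap_natCast_of_mem {α : ℝ} {q : P.Section} {n : ℕ} (hq : q.1.1 = n)
    (h : wrap (P.p n) (q.1.2 + α) ∈ Ico (-P.p (n + 1)) (P.p (n + 1))) :
    (P.returnMap α q).1 = (((n + 1 : ℕ) : ℤ), wrap (P.p n) (q.1.2 + α)) := by
  simp only [returnMap, hq, halfWidth_natCast]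
  rw [P.intGlue_natCast_of_mem h]
  push_cast
  rfl

theorem returnMap_natCast_of_notMem {α : ℝ} {q : P.Section} {n : ℕ} (hq : q.1.1 = n)
    (h : wrap (P.p n) (q.1.2 + α) ∉ Ico (-P.p (n + 1)) (P.p (n + 1))) :
    (P.returnMap α q).1 = (-((n : ℤ) + 1), wrap (P.p n) (q.1.2 + α)) := by
  simp only [returnMap, hq, halfWidth_natCast]
  rw [P.intGlue_natCast_of_notMem h]

variable (P) in
/-- The point `(0, y)` of the curve `L`. -/
def leftPoint (y : ℝ) (hy : y ∈ Ico (-P.p 0) (P.p 0)) : P.Section :=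
  ⟨(0, y), by simpa [halfWidth] using hy⟩

theorem zpow_leftPoint {α y : ℝ} (hy : y ∈ Ico (-P.p 0) (P.p 0)) {n : ℕ}
    (h : ∀ i, i ≤ n → orb P.p α y i ∈ Ico (-P.p i) (P.p i)) :
    ∀ i : ℕ, i ≤ n → ((P.returnPerm α ^ (i : ℤ)) (P.leftPoint y hy)).1 =
      ((i : ℤ), orb P.p α y i) := by
  intro i
  induction i with
  | zero => intro _; rfl
  | succ i ih =>
    intro hi
    have ih := ih (by omega)
    have hm := h (i + 1) hi
    rw [Nat.cast_succ, returnPerm_zpow_succ, returnMap_natCast_of_mem (n := i) (by rw [ih])]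
    · simp only [ih, orb, Nat.cast_succ]
    · rw [ih]
      exact hm

theorem flow_leftPoint_fst {θ y : ℝ} (hθ : 0 < Real.cos θ) (hy : y ∈ Ico (-P.p 0) (P.p 0))
    {n : ℕ} (h : ∀ i, i ≤ n → orb P.p (Real.tan θ) y i ∈ Ico (-P.p i) (P.p i)) {t : ℝ}
    (ht : 0 ≤ t) (htn : t * Real.cos θ ≤ n) :
    (P.flow θ (P.leftPoint y hy) t).1 = t * Real.cos θ := by
  have h0 : 0 ≤ ⌊t * Real.cos θ⌋ := Int.floor_nonneg.2 (by positivity)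
  obtain ⟨i, hi⟩ := Int.eq_ofNat_of_zero_le h0
  have hfl := Int.floor_add_fract (t * Real.cos θ)
  have hin : i ≤ n := by
    have h1 := Int.floor_le (t * Real.cos θ)
    rw [hi, Int.cast_natCast] at h1
    exact_mod_cast h1.trans htn
  have hz := zpow_leftPoint hy h i hin
  simp only [flow, hi]
  rw [hz]
  rw [hi] at hfl
  exact hfl

theorem notMem_verticalSides {q : ℝ × ℝ} (h : 0 < q.1) : q ∉ P.verticalSides := by
  rintro (⟨h0, -⟩ | ⟨-, k, -, hk, -⟩)
  · linarith
  · have : (0 : ℝ) ≤ k := by positivity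
    linarith

/-- Without collisions the abscissa at time t is t cos θ, so the orbit crosses G_1, ..., G_n one
after the other. -/
theorem mem_reachSet_iff {θ : ℝ} (hθ : 0 < Real.cos θ) {n : ℕ} (hn : 1 ≤ n) {y : ℝ} :
    y ∈ P.reachSet θ n ↔ ∀ i, i ≤ n → orb P.p (Real.tan θ) y i ∈ Ico (-P.p i) (P.p i) := by
  constructor
  · rintro ⟨⟨-, hy⟩, γ, hγ, hγ0, t, ht, ⟨hX, hY⟩, hv⟩
    change y ∈ Ico (-P.p 0) (P.p 0) at hy
    have hq : γ 0 = (P.leftPoint y hy).toPlane := by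
      rw [hγ0]
      simp [leftPoint, Section.toPlane]
    have key : ∀ j : ℕ, (j : ℝ) ≤ t * Real.cos θ →
        ∀ i, i ≤ j → orb P.p (Real.tan θ) y i ∈ Ico (-P.p i) (P.p i) := by
      intro j
      induction j with
      | zero =>
        intro _ i hi
        obtain rfl : i = 0 := by omega
        exact hy
      | succ j ih =>
        intro hj
        push_cast at hj
        have ih := ih (by linarith)
        have hz := zpow_leftPoint hy ih j le_rfl
        have hm : orb P.p (Real.tan θ) y (j + 1) ∈ Ico (-P.p (j + 1)) (P.p (j + 1)) := by
          by_contra hm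
          have hr := returnMap_natCast_of_notMem (α := Real.tan θ) (n := j)
            (q := (P.returnPerm (Real.tan θ) ^ (j : ℤ)) (P.leftPoint y hy)) (by rw [hz])
            (by rw [hz]; exact hm)
          have hg := hγ.eq_zpow hθ hq ((j : ℤ) + 1)
          rw [returnPerm_zpow_succ] at hg
          -- Missing G_(j+1) puts the orbit on a vertical side at time (j+1)/cos θ, which is at most
          -- t.
          refine hv (0 + (((j : ℤ) + 1 : ℤ) : ℝ) / Real.cos θ) ⟨?_, ?_⟩ (Or.inr
            ⟨hγ.mem_surface _, j + 1, by omega, ?_, ?_⟩)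
          · push_cast
            positivity
          · push_cast
            rw [zero_add, div_le_iff₀ hθ]
            exact hj
          · rw [hg, Section.toPlane, hr]
            push_cast
            ring
          · rw [hg, Section.toPlane, hr, hz]
            exact hm
        intro i hi
        rcases Nat.lt_or_eq_of_le hi with hi | rfl
        · exact ih i (by omega)
        · exact hm
    obtain ⟨N, hN⟩ := Int.eq_ofNat_of_zero_le (Int.floor_nonneg.2 (by positivity :
      0 ≤ t * Real.cos θ))
    have hNle := Int.floor_le (t * Real.cos θ)
    rw [hN, Int.cast_natCast] at hNle
    have hkN := key N hNle
    have hf := hγ.eq_flow hθ hq t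
    rw [zero_add] at hf
    have hz := zpow_leftPoint hy hkN N le_rfl
    have hXt : (γ t).1 = t * Real.cos θ := by
      have hfl := Int.floor_add_fract (t * Real.cos θ)
      rw [hf]
      simp only [flow, hN]
      rw [hz]
      rw [hN] at hfl
      exact hfl
    exact key n (by rw [← hXt, hX])
  · intro h
    have hy : y ∈ Ico (-P.p 0) (P.p 0) := h 0 (Nat.zero_le n)
    have hnpos : (0 : ℝ) < n := by exact_mod_cast hn
    have htn : (n : ℝ) / Real.cos θ * Real.cos θ = ((n : ℤ) : ℝ) := by
      rw [div_mul_cancel₀ _ hθ.ne', Int.cast_natCast]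
    refine ⟨⟨rfl, hy⟩, P.flow θ (P.leftPoint y hy), P.isTrajectory_flow hθ _, ?_,
      n / Real.cos θ, by positivity, ?_, ?_⟩
    · rw [P.flow_of_fract_eq_zero _ (by simp)]
      simp [leftPoint, Section.toPlane]
    · rw [P.flow_of_fract_eq_zero _ (by rw [htn, Int.fract_intCast]), htn, Int.floor_intCast,
        Section.toPlane, zpow_leftPoint hy h n le_rfl]
      exact ⟨Int.cast_natCast n, h n le_rfl⟩
    · rintro s ⟨hs0, hs⟩
      apply notMem_verticalSides
      rw [flow_leftPoint_fst hθ hy h hs0.le ((le_div_iff₀ hθ).1 hs)]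
      positivity

theorem mem_escapeSet_iff {θ : ℝ} (hθ : 0 < Real.cos θ) {y : ℝ} :
    y ∈ P.escapeSet θ ↔ ∀ i, orb P.p (Real.tan θ) y i ∈ Ico (-P.p i) (P.p i) := by
  simp only [escapeSet, mem_iInter]
  constructor
  · intro h i
    exact (mem_reachSet_iff hθ (by omega)).1 (h (i + 1) (by omega)) i (by omega)
  · intro h n hn
    exact (mem_reachSet_iff hθ hn).2 fun i _ => h i

theorem isEscapeOrbit_iff {θ : ℝ} (hθ : 0 < Real.cos θ) {O : Set (ℝ × ℝ)} :
    P.IsEscapeOrbit θ O ↔ ∃ (y : ℝ) (hy : y ∈ Ico (-P.p 0) (P.p 0)),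
      (∀ i, orb P.p (Real.tan θ) y i ∈ Ico (-P.p i) (P.p i)) ∧
        O = range (P.flow θ (P.leftPoint y hy)) := by
  constructor
  · rintro ⟨γ, hγ, rfl, -, hlim⟩
    obtain ⟨t₁, ht₁⟩ := eventually_atTop.1 (hlim.eventually_ge_atTop 0)
    obtain ⟨q, hq⟩ := hγ.exists_section hθ t₁
    set t₂ := t₁ + (1 - Int.fract (γ t₁).1) / Real.cos θ with ht₂
    have ht : t₁ ≤ t₂ := by
      have := Int.fract_lt_one (γ t₁).1
      have : 0 ≤ (1 - Int.fract (γ t₁).1) / Real.cos θ := div_nonneg (by linarith) hθ.le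
      linarith
    set T := P.returnPerm (Real.tan θ) with hT
    -- X stays nonnegative after time t₁, which rules out collisions, as these lead to X = -k.
    have hnn : ∀ j : ℕ, 0 ≤ ((T ^ (j : ℤ)) q).1.1 := by
      intro j
      have h1 := hγ.eq_zpow hθ hq j
      have h2 := ht₁ (t₂ + ((j : ℤ) : ℝ) / Real.cos θ) (by
        have : 0 ≤ ((j : ℤ) : ℝ) / Real.cos θ := by
          rw [Int.cast_natCast]
          positivity
        linarith)
      rw [h1] at h2
      exact Int.cast_nonneg_iff.1 h2
    obtain ⟨k, hk⟩ := Int.eq_ofNat_of_zero_le (hnn 0)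
    have hk : q.1.1 = k := hk
    have hstep : ∀ j : ℕ, ((T ^ (j : ℤ)) q).1.1 = ((k + j : ℕ) : ℤ) →
        ((T ^ ((j + 1 : ℕ) : ℤ)) q).1 =
          (((k + j + 1 : ℕ) : ℤ), wrap (P.p (k + j)) (((T ^ (j : ℤ)) q).1.2 + Real.tan θ)) := by
      intro j hj
      have hn := hnn (j + 1)
      rw [Nat.cast_succ, hT, returnPerm_zpow_succ, ← hT] at hn ⊢
      by_cases hm : wrap (P.p (k + j)) (((T ^ (j : ℤ)) q).1.2 + Real.tan θ) ∈
          Ico (-P.p (k + j + 1)) (P.p (k + j + 1))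
      · exact returnMap_natCast_of_mem hj hm
      · rw [returnMap_natCast_of_notMem hj hm] at hn
        simp only at hn
        omega
    have hfst : ∀ j : ℕ, ((T ^ (j : ℤ)) q).1.1 = ((k + j : ℕ) : ℤ) := by
      intro j
      induction j with
      | zero => simpa using hk
      | succ j ih => rw [hstep j ih]; rfl
    have hpath : ∀ n, IsPath P.p (Real.tan θ) (fun i => ((T ^ ((i - k : ℕ) : ℤ)) q).1.2) k n := by
      intro n
      constructor
      · intro i hi _
        have := ((T ^ ((i - k : ℕ) : ℤ)) q).2
        rw [hfst, halfWidth_natCast, Nat.add_sub_cancel' hi] at this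
        exact this
      · intro i hi _
        have := hstep (i - k) (hfst _)
        simp only [Nat.sub_add_comm hi]
        rw [this, Nat.add_sub_cancel' hi]
        exact wrap_eq _ _
    obtain ⟨z, hz1, hz2⟩ := exists_isPath_extend (α := Real.tan θ) P.p_pos k
      (fun i => ((T ^ ((i - k : ℕ) : ℤ)) q).1.2)
    have hz : ∀ n, IsPath P.p (Real.tan θ) z 0 n := fun n => hz2 n (hpath n)
    have horb : ∀ i, orb P.p (Real.tan θ) (z 0) i ∈ Ico (-P.p i) (P.p i) := fun i => by
      rw [← (hz i).eq_orb P.p_antitone i le_rfl]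
      exact (hz i).1 i (Nat.zero_le i) le_rfl
    have hy : z 0 ∈ Ico (-P.p 0) (P.p 0) := horb 0
    refine ⟨z 0, hy, horb, ?_⟩
    -- The path extended back to L and the orbit through `q` agree at level k, so `q` lies on the
    -- orbit of `z 0`.
    have hTk : (T ^ (k : ℤ)) (P.leftPoint (z 0) hy) = q := by
      apply Subtype.ext
      rw [hT, zpow_leftPoint hy (fun i _ => horb i) k le_rfl,
        ← (hz k).eq_orb P.p_antitone k le_rfl, hz1 k le_rfl]
      refine Prod.ext hk.symm ?_
      simp
    have hstart := hγ.eq_zpow hθ hq (-(k : ℤ))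
    rw [← hT, ← hTk, ← Equiv.Perm.mul_apply, ← zpow_add, neg_add_cancel, zpow_zero,
      Equiv.Perm.one_apply] at hstart
    ext x
    constructor
    · rintro ⟨t, rfl⟩
      refine ⟨t - (t₂ + ((-(k : ℤ) : ℤ) : ℝ) / Real.cos θ), ?_⟩
      rw [← hγ.eq_flow hθ hstart]
      congr 1
      ring
    · rintro ⟨t, rfl⟩
      exact ⟨_, hγ.eq_flow hθ hstart t⟩
  · rintro ⟨y, hy, h, rfl⟩
    have hX : ∀ t : ℝ, 0 ≤ t → (P.flow θ (P.leftPoint y hy) t).1 = t * Real.cos θ := by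
      intro t ht
      obtain ⟨n, hn⟩ := exists_nat_ge (t * Real.cos θ)
      exact flow_leftPoint_fst hθ hy (fun i _ => h i) ht hn
    refine ⟨_, P.isTrajectory_flow hθ _, rfl, ⟨0, fun t ht => notMem_verticalSides ?_⟩, ?_⟩
    · rw [hX t ht.le]
      positivity
    · refine (tendsto_id.atTop_mul_const hθ).congr' ?_
      filter_upwards [eventually_ge_atTop 0] with t ht
      exact (hX t ht).symm

/-- The exceptional angles lie in the image under arctan of a null set, and differentiable maps
preserve null sets. -/
theorem ae_restrict_tan {s : Set ℝ} (hs : ∀ᵐ α : ℝ, α ∈ s) :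
    ∀ᵐ θ ∂(volume.restrict (Ioo (0 : ℝ) (Real.pi / 2))), Real.tan θ ∈ s := by
  rw [ae_restrict_iff' measurableSet_Ioo]
  have h := addHaar_image_eq_zero_of_differentiableOn_of_addHaar_eq_zero volume
    (f := Real.arctan) (s := sᶜ) Real.differentiable_arctan.differentiableOn hs
  filter_upwards [measure_eq_zero_iff_ae_notMem.1 h] with θ hθ hmem
  by_contra hn
  exact hθ ⟨Real.tan θ, hn, Real.arctan_tan (by linarith [hmem.1, Real.pi_pos]) hmem.2⟩

end Dynamics

end StepBilliard

theorem mainTheorem3 (P : StepBilliard) (lam : ℝ) (hlam_pos : 0 < lam)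
    (hlam_lt : lam < (Real.sqrt 6 - 1) / 5) (hP : ∀ n : ℕ, P.p (n + 1) ≤ lam * P.p n) :
    ∀ᵐ θ ∂(MeasureTheory.volume.restrict (Set.Ioo (0 : ℝ) (Real.pi / 2))),
      (∃! O : Set (ℝ × ℝ), P.IsEscapeOrbit θ O) ∧ (∃! y : ℝ, y ∈ P.escapeSet θ) := by
  -- This gives λ < 29/100.
  have h6 : Real.sqrt 6 < 245 / 100 := by
    rw [Real.sqrt_lt' (by norm_num)]
    norm_num
  filter_upwards [StepBilliard.ae_restrict_tan (StepBilliard.ae_existsUnique_orb P.p_pos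
    P.p_antitone P.p_tendsto hlam_pos (by linarith) hP), ae_restrict_mem measurableSet_Ioo]
    with θ hθ hmem
  have hcos : 0 < Real.cos θ :=
    Real.cos_pos_of_mem_Ioo ⟨by linarith [hmem.1, Real.pi_pos], hmem.2⟩
  obtain ⟨y, hy, huniq⟩ := hθ
  refine ⟨⟨_, (StepBilliard.isEscapeOrbit_iff hcos).2 ⟨y, hy 0, hy, rfl⟩, fun O hO => ?_⟩,
    ⟨y, (StepBilliard.mem_escapeSet_iff hcos).2 hy,
      fun y' hy' => huniq y' ((StepBilliard.mem_escapeSet_iff hcos).1 hy')⟩⟩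
  obtain ⟨y', hy'0, hy', rfl⟩ := (StepBilliard.isEscapeOrbit_iff hcos).1 hO
  obtain rfl : y' = y := huniq y' hy'
  rfl
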